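/- Let $L$ be a (finite-dimensional) complex simple Lie algebra of type $E_6$, with Cartan subalgebra $H$, root system $\Phi$, and fundamental roots $a,b,c,d,e,f$, numbered so that the Dynkin diagram is the chain $a - c - d - e - f$ with $b$ joined to $d$. Write $\alpha\beta\gamma\delta\epsilon\zeta$ for $\alpha a+\beta b+\gamma c+\delta d+\epsilon e+\zeta f$. For $x,y$ in the real span of the fundamental roots, put $x\prec y$ if the first nonzero coefficient of $y-x$, the coefficients being taken in the order $f,e,b,d,c,a$, is positive. A pair $(r,s)$ of roots is special if $r+s\in\Phi$ and $0\prec r\prec s$; it is extraspecial if moreover $r\preceq r'$ for every special pair $(r',s')$ with $r'+s'=r+s$. For each $r\in\Phi$ let $e_r\in L_r$ be a root vector, chosen so that $[e_r,e_{-r}]=h_r$ is the coroot of $r$ for all $r \in \Phi$, and let $N_{r,s}$ be the structure constants: $[e_r,e_s]=N_{r,s}e_{r+s}$ if $r,s,r+s\in\Phi$, and $N_{r,s}=0$ if $r,s\in\Phi$, $r+s\notin\Phi$. Theorem. Suppose that $N_{r,s}=1$ for every extraspecial pair $(r,s)$. Then all structure constants $N_{r,s}$, $r,s\in\Phi$,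 are as follows. The roots are $\pm r_1,\dots,\pm r_{36}$, where $r_1,\dots,r_{36}$ = $100000$, $001000$, $101000$, $000100$, $001100$, $101100$, $010000$, $010100$, $011100$, $111100$, $000010$, $000110$, $001110$, $101110$, $010110$, $011110$, $111110$, $011210$, $111210$, $112210$, $000001$, $000011$, $000111$, $001111$, $101111$, $010111$, $011111$, $111111$, $011211$, $111211$, $112211$, $011221$, $111221$, $112221$, $112321$, $122321$. For $1\le i,j\le 36$ one has $N_{r_i,r_j}=P_{ij}$, $N_{r_i,-r_j}=M_{ij}$, $N_{-r_i,r_j}=-M_{ji}$ and $N_{-r_i,-r_j}=-P_{ij}$, where $P$ and $M$ are the following $36\times36$ matrices with entries in $\{0,1,-1\}$. In the list for row $i$, an entry $j$ means that the entry in column $j$ is $1$, an entry $\overline{j}$ means that the entry in column $j$ is $-1$, and all entries in columns that are not listed are $0$. Rows of $P$ (the constants $N_{r_i,r_j}$): - $1$: $2, 5, 9, 13, 16, 18, 24, 27, 29, 32$ - $2$: $\overline{1}, 4, 8, 12, 15, 19, 23, 26, 30, 33$ - $3$: $4, 8, 12, 15, \overline{18}, 23, 26, \overline{29}, \overline{32}$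 - $4$: $\overline{2}, \overline{3}, 7, 11, 16, 17, 22, 27, 28, 34$ - $5$: $\overline{1}, 7, 11, \overline{15}, 17, 22, \overline{26}, 28, \overline{33}$ - $6$: $7, 11, \overline{15}, \overline{16}, 22, \overline{26}, \overline{27}, 32$ - $7$: $\overline{4}, \overline{5}, \overline{6}, 12, 13, 14, 23, 24, 25, 35$ - $8$: $\overline{2}, \overline{3}, \overline{11}, 13, 14, \overline{22}, 24, 25, \overline{34}$ - $9$: $\overline{1}, \overline{11}, \overline{12}, 14, \overline{22}, \overline{23}, 25, 33$ - $10$: $\overline{11}, \overline{12}, \overline{13}, \overline{22}, \overline{23}, \overline{24}, \overline{32}$ - $11$: $\overline{4}, \overline{5}, \overline{6}, 8, 9, 10, 21, 29, 30, 31$ - $12$: $\overline{2}, \overline{3}, \overline{7}, 9, 10, 21, \overline{27}, \overline{28}, 31$ - $13$: $\overline{1}, \overline{7}, \overline{8}, 10, 21, 26, \overline{28}, \overline{30}$ - $14$: $\overline{7}, \overline{8}, \overline{9}, 21, 26, 27, 29$ - $15$: $\overline{2}, \overline{3}, 5, 6, 21, 24, 25, 31$ - $16$: $\overline{1}, \overline{4},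 6, 21, \overline{23}, 25, \overline{30}$ - $17$: $\overline{4}, \overline{5}, 21, \overline{23}, \overline{24}, 29$ - $18$: $\overline{1}, 3, 21, 22, 25, 28$ - $19$: $\overline{2}, 21, 22, \overline{24}, \overline{27}$ - $20$: $21, 22, 23, 26$ - $21$: $\overline{11}, \overline{12}, \overline{13}, \overline{14}, \overline{15}, \overline{16}, \overline{17}, \overline{18}, \overline{19}, \overline{20}$ - $22$: $\overline{4}, \overline{5}, \overline{6}, 8, 9, 10, \overline{18}, \overline{19}, \overline{20}$ - $23$: $\overline{2}, \overline{3}, \overline{7}, 9, 10, 16, 17, \overline{20}$ - $24$: $\overline{1}, \overline{7}, \overline{8}, 10, \overline{15}, 17, 19$ - $25$: $\overline{7}, \overline{8}, \overline{9}, \overline{15}, \overline{16}, \overline{18}$ - $26$: $\overline{2}, \overline{3}, 5, 6, \overline{13}, \overline{14}, \overline{20}$ - $27$: $\overline{1}, \overline{4}, 6, 12, \overline{14}, 19$ - $28$: $\overline{4}, \overline{5}, 12, 13, \overline{18}$ - $29$: $\overline{1}, 3, \overline{11}, \overline{14}, \overline{17}$ - $30$: $\overline{2}, \overline{11}, 13,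 16$ - $31$: $\overline{11}, \overline{12}, \overline{15}$ - $32$: $\overline{1}, 3, \overline{6}, 10$ - $33$: $\overline{2}, 5, \overline{9}$ - $34$: $\overline{4}, 8$ - $35$: $\overline{7}$ - $36$: (none) Rows of $M$ (the constants $N_{r_i,-r_j}$): - $1$: $\overline{3}, \overline{6}, \overline{10}, \overline{14}, \overline{17}, \overline{19}, \overline{25}, \overline{28}, \overline{30}, \overline{33}$ - $2$: $3, \overline{5}, \overline{9}, \overline{13}, \overline{16}, \overline{20}, \overline{24}, \overline{27}, \overline{31}, \overline{34}$ - $3$: $\overline{1}, 2, \overline{6}, \overline{10}, \overline{14}, \overline{17}, 20, \overline{25}, \overline{28}, 31, 34$ - $4$: $5, 6, \overline{8}, \overline{12}, \overline{18}, \overline{19}, \overline{23}, \overline{29}, \overline{30}, \overline{35}$ - $5$: $\overline{2}, 4, 6, \overline{9}, \overline{13}, 18, \overline{20}, \overline{24}, 29, \overline{31}, 35$ - $6$: $\overline{1}, \overline{3}, 4, 5, \overline{10}, \overline{14}, 19, 20, \overline{25}, 30, 31, \overline{35}$ - $7$: $8, 9, 10, \overline{15}, \overline{16}, \overline{17}, \overline{26},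 \overline{27}, \overline{28}, \overline{36}$ - $8$: $\overline{4}, 7, 9, 10, 15, \overline{18}, \overline{19}, 26, \overline{29}, \overline{30}, 36$ - $9$: $\overline{2}, \overline{5}, 7, 8, 10, 16, 18, \overline{20}, 27, 29, \overline{31}, \overline{36}$ - $10$: $\overline{1}, \overline{3}, \overline{6}, 7, 8, 9, 17, 19, 20, 28, 30, 31, 36$ - $11$: $12, 13, 14, \overline{15}, \overline{16}, \overline{17}, \overline{22}, \overline{32}, \overline{33}, \overline{34}$ - $12$: $\overline{4}, 11, 13, 14, 15, \overline{18}, \overline{19}, \overline{23}, 32, 33, \overline{35}$ - $13$: $\overline{2}, \overline{5}, 11, 12, 14, 16, 18, \overline{20}, \overline{24}, \overline{32}, 34, 35$ - $14$: $\overline{1}, \overline{3}, \overline{6}, 11, 12, 13, 17, 19, 20, \overline{25}, \overline{33}, \overline{34}, \overline{35}$ - $15$: $\overline{7}, 8, \overline{11}, 12, 16, 17, \overline{18}, \overline{19}, \overline{26}, \overline{32}, \overline{33}, \overline{36}$ - $16$: $\overline{2}, \overline{7}, 9, \overline{11}, 13, 15, 17, 18, \overline{20}, \overline{27}, 32, \overline{34},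 36$ - $17$: $\overline{1}, \overline{3}, \overline{7}, 10, \overline{11}, 14, 15, 16, 19, 20, \overline{28}, 33, 34, \overline{36}$ - $18$: $\overline{4}, 5, \overline{8}, 9, \overline{12}, 13, \overline{15}, 16, 19, \overline{20}, \overline{29}, \overline{32}, \overline{35}, \overline{36}$ - $19$: $\overline{1}, \overline{4}, 6, \overline{8}, 10, \overline{12}, 14, \overline{15}, 17, 18, 20, \overline{30}, \overline{33}, 35, 36$ - $20$: $\overline{2}, 3, \overline{5}, 6, \overline{9}, 10, \overline{13}, 14, \overline{16}, 17, \overline{18}, 19, \overline{31}, \overline{34}, \overline{35}, \overline{36}$ - $21$: $22, 23, 24, 25, 26, 27, 28, 29, 30, 31$ - $22$: $\overline{11}, 21, 23, 24, 25, \overline{26}, \overline{27}, \overline{28}, 32, 33, 34$ - $23$: $\overline{4}, \overline{12}, 21, 22, 24, 25, 26, \overline{29}, \overline{30}, \overline{32}, \overline{33}, 35$ - $24$: $\overline{2}, \overline{5}, \overline{13}, 21, 22, 23, 25, 27, 29, \overline{31}, 32, \overline{34}, \overline{35}$ - $25$: $\overline{1}, \overline{3}, \overline{6}, \overline{14}, 21,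 22, 23, 24, 28, 30, 31, 33, 34, 35$ - $26$: $\overline{7}, 8, \overline{15}, 21, \overline{22}, 23, 27, 28, \overline{29}, \overline{30}, 32, 33, 36$ - $27$: $\overline{2}, \overline{7}, 9, \overline{16}, 21, \overline{22}, 24, 26, 28, 29, \overline{31}, \overline{32}, 34, \overline{36}$ - $28$: $\overline{1}, \overline{3}, \overline{7}, 10, \overline{17}, 21, \overline{22}, 25, 26, 27, 30, 31, \overline{33}, \overline{34}, 36$ - $29$: $\overline{4}, 5, \overline{8}, 9, \overline{18}, 21, \overline{23}, 24, \overline{26}, 27, 30, \overline{31}, 32, 35, 36$ - $30$: $\overline{1}, \overline{4}, 6, \overline{8}, 10, \overline{19}, 21, \overline{23}, 25, \overline{26}, 28, 29, 31, 33, \overline{35}, \overline{36}$ - $31$: $\overline{2}, 3, \overline{5}, 6, \overline{9}, 10, \overline{20}, 21, \overline{24}, 25, \overline{27}, 28, \overline{29}, 30, 34, 35, 36$ - $32$: $\overline{11}, 12, \overline{13}, \overline{15}, 16, \overline{18}, 22, \overline{23}, 24, 26, \overline{27}, 29, 33, \overline{34}, 35, \overline{36}$ - $33$: $\overline{1}, \overline{11},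 12, \overline{14}, \overline{15}, 17, \overline{19}, 22, \overline{23}, 25, 26, \overline{28}, 30, 32, 34, \overline{35}, 36$ - $34$: $\overline{2}, 3, \overline{11}, 13, \overline{14}, \overline{16}, 17, \overline{20}, 22, \overline{24}, 25, 27, \overline{28}, 31, \overline{32}, 33, 35, \overline{36}$ - $35$: $\overline{4}, 5, \overline{6}, \overline{12}, 13, \overline{14}, \overline{18}, 19, \overline{20}, 23, \overline{24}, 25, 29, \overline{30}, 31, 32, \overline{33}, 34, 36$ - $36$: $\overline{7}, 8, \overline{9}, 10, \overline{15}, 16, \overline{17}, \overline{18}, 19, \overline{20}, 26, \overline{27}, 28, 29, \overline{30}, 31, \overline{32}, 33, \overline{34}, 35$ -/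

import Mathlib

open LieAlgebra LieModule

/-! ## Root vectors and structure constants

`L` is a complex Lie algebra with Cartan subalgebra `H`. Its roots are indexed by `H.root`, and
`(IsKilling.rootSystem H).root r` is the root `r` as a linear functional on `H`. -/

namespace E6

section StructureConstants

variable {L : Type*} [LieRing L] [LieAlgebra ℂ L] [FiniteDimensional ℂ L]
  [LieAlgebra.IsKilling ℂ L] {H : LieSubalgebra ℂ L} [H.IsCartanSubalgebra]

/-- A choice of root vectors `e_r ∈ L_r`, one for each root `r`, such that
`[e_r, e_{-r}] = h_r` is the coroot of `r`. -/
structure IsRootVectorSystem (e : H.root → L) : Prop where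
  mem_rootSpace : ∀ r : H.root, e r ∈ rootSpace H (r.1 : H → ℂ)
  lie_neg : ∀ r s : H.root,
    (IsKilling.rootSystem H).root s = -(IsKilling.rootSystem H).root r →
      ⁅e r, e s⁆ = ((IsKilling.rootSystem H).coroot r : L)

open Classical in
/-- The structure constant `N_{r,s}`: the scalar with `[e_r, e_s] = N_{r,s} e_{r+s}` if `r + s` is
a root, and `0` otherwise. -/
noncomputable def structConst (e : H.root → L) (r s : H.root) : ℂ :=
  if h : ∃ c : ℂ, ∃ t : H.root, (IsKilling.rootSystem H).root t =
      (IsKilling.rootSystem H).root r + (IsKilling.rootSystem H).root s ∧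
      ⁅e r, e s⁆ = c • e t
  then h.choose else 0

/-- For a choice of root vectors, the structure constants satisfy their defining equation. -/
theorem lie_eq_structConst_smul {e : H.root → L}
    (he : IsRootVectorSystem e) {r s t : H.root} (h : (IsKilling.rootSystem H).root t =
      (IsKilling.rootSystem H).root r + (IsKilling.rootSystem H).root s) :
    ⁅e r, e s⁆ = structConst e r s • e t := by
  have ht0 : e t ≠ 0 := by
    intro h0
    have h1 := he.lie_neg t ((IsKilling.rootSystem H).reflectionPerm t t)
      (by rw [RootPairing.root_reflectionPerm, RootPairing.reflection_apply_self])
    rw [h0, zero_lie] at h1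
    have := (IsKilling.rootSystem H).ne_zero t
    have h2 : (IsKilling.rootSystem H).coroot t = 0 := by exact_mod_cast h1.symm
    have := (IsKilling.rootSystem H).root_coroot_eq_pairing t t
    simp only [h2, map_zero, RootPairing.pairing_same] at this
    simp at this
  have hm : ⁅e r, e s⁆ ∈ rootSpace H (t.1 : H → ℂ) := by
    have := LieAlgebra.lie_mem_genWeightSpace_of_mem_genWeightSpace (he.mem_rootSpace r) (he.mem_rootSpace s)
    have h' : (t.1 : H → ℂ) = (r.1 : H → ℂ) + s.1 := by
      funext x
      have := congrArg (fun f => f x) h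
      simpa using this
    rw [h']; exact this
  have hf := LieAlgebra.IsKilling.finrank_rootSpace_eq_one t.1 (by exact (Finset.mem_filter.mp t.2).2)
  have hex : ∃ c : ℂ, c • e t = ⁅e r, e s⁆ := by
    obtain ⟨c, hc⟩ := (finrank_eq_one_iff_of_nonzero' (⟨e t, he.mem_rootSpace t⟩ : rootSpace H (t.1 : H → ℂ)) (by simpa [Subtype.ext_iff] using ht0)).1 hf ⟨_, hm⟩
    exact ⟨c, by simpa [Subtype.ext_iff] using hc⟩
  obtain ⟨c, hc⟩ := hex
  have hh : ∃ c : ℂ, ∃ t : H.root, (IsKilling.rootSystem H).root t =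
      (IsKilling.rootSystem H).root r + (IsKilling.rootSystem H).root s ∧
      ⁅e r, e s⁆ = c • e t := ⟨c, t, h, hc.symm⟩
  rw [structConst, dif_pos hh]
  obtain ⟨t', ht', h2⟩ := hh.choose_spec
  have : t' = t := (IsKilling.rootSystem H).root.injective (ht'.trans h.symm)
  rw [this] at h2
  exact h2

end StructureConstants

/-! ## The order and extraspecial pairs -/

section Order

variable {V : Type*} [AddCommGroup V] [Module ℂ V]

/-- The fundamental roots `a, b, c, d, e, f` are numbered `0, 1, 2, 3, 4, 5`; this lists them in the
order `f, e, b, d, c, a` in which coefficients are compared. -/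
def comparisonOrder : Fin 6 → Fin 6 := ![5, 4, 1, 3, 2, 0]

/-- `x ≺ y`: the difference `y - x` is a real combination of the fundamental roots `α`, and
its first nonzero coefficient, in the order `f, e, b, d, c, a`, is positive. -/
def Prec (α : Fin 6 → V) (x y : V) : Prop :=
  ∃ τ : Fin 6 → ℝ, y - x = ∑ k, (τ k : ℂ) • α k ∧
    ∃ m : Fin 6, 0 < τ (comparisonOrder m) ∧ ∀ l < m, τ (comparisonOrder l) = 0

/-- `(r, s)` is a special pair of the set of roots `Φ`: `r, s, r + s ∈ Φ` and `0 ≺ r ≺ s`. -/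
def IsSpecial (Φ : Set V) (α : Fin 6 → V) (r s : V) : Prop :=
  r ∈ Φ ∧ s ∈ Φ ∧ r + s ∈ Φ ∧ Prec α 0 r ∧ Prec α r s

/-- `(r, s)` is an extraspecial pair: it is special, and `r` is least among the first
members of all special pairs with the same sum. -/
def IsExtraspecial (Φ : Set V) (α : Fin 6 → V) (r s : V) : Prop :=
  IsSpecial Φ α r s ∧
    ∀ r' s' : V, IsSpecial Φ α r' s' → r' + s' = r + s → r = r' ∨ Prec α r r'

end Order

/-! ## The list of positive roots and the tables -/

/-- The coefficients, with respect to `a, b, c, d, e, f`, of the positive roots `r_1, …, r_36`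
(here numbered from `0`), in increasing order for `≺`. -/
def posCoeff : Fin 36 → Fin 6 → ℤ :=
  ![![1, 0, 0, 0, 0, 0], ![0, 0, 1, 0, 0, 0], ![1, 0, 1, 0, 0, 0], ![0, 0, 0, 1, 0, 0],
    ![0, 0, 1, 1, 0, 0], ![1, 0, 1, 1, 0, 0], ![0, 1, 0, 0, 0, 0], ![0, 1, 0, 1, 0, 0],
    ![0, 1, 1, 1, 0, 0], ![1, 1, 1, 1, 0, 0], ![0, 0, 0, 0, 1, 0], ![0, 0, 0, 1, 1, 0],
    ![0, 0, 1, 1, 1, 0], ![1, 0, 1, 1, 1, 0], ![0, 1, 0, 1, 1, 0], ![0, 1, 1, 1, 1, 0],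
    ![1, 1, 1, 1, 1, 0], ![0, 1, 1, 2, 1, 0], ![1, 1, 1, 2, 1, 0], ![1, 1, 2, 2, 1, 0],
    ![0, 0, 0, 0, 0, 1], ![0, 0, 0, 0, 1, 1], ![0, 0, 0, 1, 1, 1], ![0, 0, 1, 1, 1, 1],
    ![1, 0, 1, 1, 1, 1], ![0, 1, 0, 1, 1, 1], ![0, 1, 1, 1, 1, 1], ![1, 1, 1, 1, 1, 1],
    ![0, 1, 1, 2, 1, 1], ![1, 1, 1, 2, 1, 1], ![1, 1, 2, 2, 1, 1], ![0, 1, 1, 2, 2, 1],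
    ![1, 1, 1, 2, 2, 1], ![1, 1, 2, 2, 2, 1], ![1, 1, 2, 3, 2, 1], ![1, 2, 2, 3, 2, 1]]

/-- The positive root `r_{i+1}`, for fundamental roots `α`. -/
def posRoot {V : Type*} [AddCommGroup V] [Module ℂ V] (α : Fin 6 → V) (i : Fin 36) : V :=
  ∑ k, posCoeff i k • α k

/-- The value at column `j` of a row of a table, given as the list of the columns with entry `1` and
the list of the columns with entry `-1`; all other entries (blank in the table) are `0`. -/
def entry (row : List ℕ × List ℕ) (j : ℕ) : ℤ :=
  if j ∈ row.1 then 1 else if j ∈ row.2 then -1 else 0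

/-- The rows `1, …, 36` of the table of the `N_{r,s}` for positive `r, s`: in row `i`, the `j` with
`N_{r_i,r_j} = 1` and the `j` with `N_{r_i,r_j} = -1`. -/
def positiveRows : Fin 36 → List ℕ × List ℕ :=
  ![([2, 5, 9, 13, 16, 18, 24, 27, 29, 32], []),
    ([4, 8, 12, 15, 19, 23, 26, 30, 33], [1]),
    ([4, 8, 12, 15, 23, 26], [18, 29, 32]),
    ([7, 11, 16, 17, 22, 27, 28, 34], [2, 3]),
    ([7, 11, 17, 22, 28], [1, 15, 26, 33]),
    ([7, 11, 22, 32], [15, 16, 26, 27]),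
    ([12, 13, 14, 23, 24, 25, 35], [4, 5, 6]),
    ([13, 14, 24, 25], [2, 3, 11, 22, 34]),
    ([14, 25, 33], [1, 11, 12, 22, 23]),
    ([], [11, 12, 13, 22, 23, 24, 32]),
    ([8, 9, 10, 21, 29, 30, 31], [4, 5, 6]),
    ([9, 10, 21, 31], [2, 3, 7, 27, 28]),
    ([10, 21, 26], [1, 7, 8, 28, 30]),
    ([21, 26, 27, 29], [7, 8, 9]),
    ([5, 6, 21, 24, 25, 31], [2, 3]),
    ([6, 21, 25], [1, 4, 23, 30]),
    ([21, 29], [4, 5, 23, 24]),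
    ([3, 21, 22, 25, 28], [1]),
    ([21, 22], [2, 24, 27]),
    ([21, 22, 23, 26], []),
    ([], [11, 12, 13, 14, 15, 16, 17, 18, 19, 20]),
    ([8, 9, 10], [4, 5, 6, 18, 19, 20]),
    ([9, 10, 16, 17], [2, 3, 7, 20]),
    ([10, 17, 19], [1, 7, 8, 15]),
    ([], [7, 8, 9, 15, 16, 18]),
    ([5, 6], [2, 3, 13, 14, 20]),
    ([6, 12, 19], [1, 4, 14]),
    ([12, 13], [4, 5, 18]),
    ([3], [1, 11, 14, 17]),
    ([13, 16], [2, 11]),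
    ([], [11, 12, 15]),
    ([3, 10], [1, 6]),
    ([5], [2, 9]),
    ([8], [4]),
    ([], [7]),
    ([], [])]

/-- The rows `1, …, 36` of the table of the `N_{r,-s}` for positive `r, s`: in row `i`, the `j` with
`N_{r_i,-r_j} = 1` and the `j` with `N_{r_i,-r_j} = -1`. -/
def mixedRows : Fin 36 → List ℕ × List ℕ :=
  ![([], [3, 6, 10, 14, 17, 19, 25, 28, 30, 33]),
    ([3], [5, 9, 13, 16, 20, 24, 27, 31, 34]),
    ([2, 20, 31, 34], [1, 6, 10, 14, 17, 25, 28]),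
    ([5, 6], [8, 12, 18, 19, 23, 29, 30, 35]),
    ([4, 6, 18, 29, 35], [2, 9, 13, 20, 24, 31]),
    ([4, 5, 19, 20, 30, 31], [1, 3, 10, 14, 25, 35]),
    ([8, 9, 10], [15, 16, 17, 26, 27, 28, 36]),
    ([7, 9, 10, 15, 26, 36], [4, 18, 19, 29, 30]),
    ([7, 8, 10, 16, 18, 27, 29], [2, 5, 20, 31, 36]),
    ([7, 8, 9, 17, 19, 20, 28, 30, 31, 36], [1, 3, 6]),
    ([12, 13, 14], [15, 16, 17, 22, 32, 33, 34]),
    ([11, 13, 14, 15, 32, 33], [4, 18, 19, 23, 35]),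
    ([11, 12, 14, 16, 18, 34, 35], [2, 5, 20, 24, 32]),
    ([11, 12, 13, 17, 19, 20], [1, 3, 6, 25, 33, 34, 35]),
    ([8, 12, 16, 17], [7, 11, 18, 19, 26, 32, 33, 36]),
    ([9, 13, 15, 17, 18, 32, 36], [2, 7, 11, 20, 27, 34]),
    ([10, 14, 15, 16, 19, 20, 33, 34], [1, 3, 7, 11, 28, 36]),
    ([5, 9, 13, 16, 19], [4, 8, 12, 15, 20, 29, 32, 35, 36]),
    ([6, 10, 14, 17, 18, 20, 35, 36], [1, 4, 8, 12, 15, 30, 33]),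
    ([3, 6, 10, 14, 17, 19], [2, 5, 9, 13, 16, 18, 31, 34, 35, 36]),
    ([22, 23, 24, 25, 26, 27, 28, 29, 30, 31], []),
    ([21, 23, 24, 25, 32, 33, 34], [11, 26, 27, 28]),
    ([21, 22, 24, 25, 26, 35], [4, 12, 29, 30, 32, 33]),
    ([21, 22, 23, 25, 27, 29, 32], [2, 5, 13, 31, 34, 35]),
    ([21, 22, 23, 24, 28, 30, 31, 33, 34, 35], [1, 3, 6, 14]),
    ([8, 21, 23, 27, 28, 32, 33, 36], [7, 15, 22, 29, 30]),
    ([9, 21, 24, 26, 28, 29, 34], [2, 7, 16, 22, 31, 32, 36]),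
    ([10, 21, 25, 26, 27, 30, 31, 36], [1, 3, 7, 17, 22, 33, 34]),
    ([5, 9, 21, 24, 27, 30, 32, 35, 36], [4, 8, 18, 23, 26, 31]),
    ([6, 10, 21, 25, 28, 29, 31, 33], [1, 4, 8, 19, 23, 26, 35, 36]),
    ([3, 6, 10, 21, 25, 28, 30, 34, 35, 36], [2, 5, 9, 20, 24, 27, 29]),
    ([12, 16, 22, 24, 26, 29, 33, 35], [11, 13, 15, 18, 23, 27, 34, 36]),
    ([12, 17, 22, 25, 26, 30, 32, 34, 36], [1, 11, 14, 15, 19, 23, 28, 35]),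
    ([3, 13, 17, 22, 25, 27, 31, 33, 35], [2, 11, 14, 16, 20, 24, 28, 32, 36]),
    ([5, 13, 19, 23, 25, 29, 31, 32, 34, 36], [4, 6, 12, 14, 18, 20, 24, 30, 33]),
    ([8, 10, 16, 19, 26, 28, 29, 31, 33, 35], [7, 9, 15, 17, 18, 20, 27, 30, 32, 34])]

/-- The table of the `N_{r,s}` for positive roots `r, s`. -/
def positiveTable (i j : Fin 36) : ℤ := entry (positiveRows i) (j + 1)

/-- The table of the `N_{r,-s}` for positive roots `r, s`. -/
def mixedTable (i j : Fin 36) : ℤ := entry (mixedRows i) (j + 1)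

end E6

/-! All roots of `E₆` have the same length, and this makes every structure constant computable from
the extraspecial ones. With the form normalized so that roots have value 1, the value at a sum or
difference of roots decides whether it can be a root. Two relations follow.

If `x`, `y`, `z`, `x + y`, `y + z`, `x + y + z` are roots, then `x + z` is neither a root nor zero,
and the Jacobi identity collapses to `N_{y,z} N_{x,y+z} = N_{x,y} N_{x+y,z}`
(`structConst_jacobi_of_roots`). If `x`, `y`, `x + y` are roots, then `N_{x,y} N_{-x,x+y} = 1`
(`structConst_mul_structConst_neg_of_roots`).

For positive roots, let `i + j` be a root with extraspecial pair `(i₀, j₀)`, and suppose that `i₀`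
is neither `i` nor `j`. Exactly one of `i - i₀`, `j - i₀` is a positive root; say `i = i₀ + q`, so
that `j₀ = q + j`. The Jacobi relation for `i₀, q, j` expresses `N_{i,j}` through `N_{q,j}` and
`N_{i₀,q}`, whose sums precede `i + j`. Induction on the sum gives the first table
(`eq_positiveTable_of_add`). The second relation transfers the values to pairs containing negative
roots (`structConst_of_add`).

That the printed tables obey these recursions is a finite check. For it, positive roots are encoded
as integers with their coefficients as decimal digits, so that addition and order of roots become
addition and order of integers. -/

namespace E6

/-! ### Identities for structure constants in a Lie algebra with nondegenerate Killing form. -/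

section RootVectors

variable {L : Type*} [LieRing L] [LieAlgebra ℂ L] [FiniteDimensional ℂ L]
  [LieAlgebra.IsKilling ℂ L] {H : LieSubalgebra ℂ L} [H.IsCartanSubalgebra]
  {e : H.root → L}

local notation "ρ" => RootPairing.root (IsKilling.rootSystem H)

/-- The bracket of two root vectors vanishes when the sum of the roots is neither a root
nor zero. -/
theorem IsRootVectorSystem.lie_eq_zero (he : IsRootVectorSystem e) {r s : H.root}
    (h : ∀ t, ρ t ≠ ρ r + ρ s) (h0 : ρ r + ρ s ≠ 0) : ⁅e r, e s⁆ = 0 := by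
  by_contra hne
  have hmem := lie_mem_genWeightSpace_of_mem_genWeightSpace
    (he.mem_rootSpace r) (he.mem_rootSpace s)
  have hbot : genWeightSpace L ((r.1 : H → ℂ) + (s.1 : H → ℂ)) ≠ ⊥ := by
    intro hb
    rw [hb] at hmem
    exact hne (by simpa using hmem)
  let χ : Weight ℂ H L := ⟨_, hbot⟩
  have hχ : χ.IsNonZero := by
    intro hz
    apply h0
    ext x
    simpa [χ] using congrFun hz x
  refine h ⟨χ, by simpa using hχ⟩ ?_
  ext x
  simp [χ]

theorem IsRootVectorSystem.ne_zero (he : IsRootVectorSystem e) (t : H.root) : e t ≠ 0 := by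
  intro h0
  have h1 := he.lie_neg t ((IsKilling.rootSystem H).reflectionPerm t t)
    (by rw [RootPairing.root_reflectionPerm, RootPairing.reflection_apply_self])
  rw [h0, zero_lie] at h1
  have h2 : (IsKilling.rootSystem H).coroot t = 0 := by exact_mod_cast h1.symm
  have h3 := (IsKilling.rootSystem H).root_coroot_eq_pairing t t
  rw [h2, map_zero, RootPairing.pairing_same] at h3
  norm_num at h3

theorem structConst_eq_zero {r s : H.root} (h : ∀ t, ρ t ≠ ρ r + ρ s) :
    structConst e r s = 0 := by
  rw [structConst, dif_neg]
  rintro ⟨-, t, ht, -⟩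
  exact h t ht

theorem structConst_swap (he : IsRootVectorSystem e) (r s : H.root) :
    structConst e r s = -structConst e s r := by
  by_cases h : ∃ t, ρ t = ρ r + ρ s
  · obtain ⟨t, ht⟩ := h
    have h1 := lie_eq_structConst_smul he ht
    have h2 := lie_eq_structConst_smul he (ht.trans (add_comm _ _))
    rw [← lie_skew, h2, ← neg_smul] at h1
    exact (smul_left_injective ℂ (he.ne_zero t) h1).symm
  · push Not at h
    rw [structConst_eq_zero h, structConst_eq_zero (fun t => add_comm (ρ r) _ ▸ h t), neg_zero]

/-- The Jacobi identity for three root vectors when one of the three pairwise sums of the roots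
is neither a root nor zero. -/
theorem structConst_jacobi (he : IsRootVectorSystem e) {x y z u v w : H.root}
    (hu : ρ u = ρ x + ρ y) (hv : ρ v = ρ y + ρ z) (hw : ρ w = ρ x + ρ y + ρ z)
    (h : ∀ t, ρ t ≠ ρ x + ρ z) (h0 : ρ x + ρ z ≠ 0) :
    structConst e y z * structConst e x v = structConst e x y * structConst e u z := by
  have h1 := leibniz_lie (e x) (e y) (e z)
  rw [he.lie_eq_zero h h0, lie_zero, add_zero, lie_eq_structConst_smul he hv,
    lie_eq_structConst_smul he hu, lie_smul, smul_lie,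
    lie_eq_structConst_smul he (t := w) (by rw [hw, hv, add_assoc]),
    lie_eq_structConst_smul he (t := w) (by rw [hw, hu]), smul_smul, smul_smul] at h1
  exact smul_left_injective ℂ (he.ne_zero w) h1

/-- If the `x`-chain through `y` consists of `y` and `x + y` only, then
`N_{x,y} N_{-x,x+y} = 1`. -/
theorem structConst_mul_structConst_neg (he : IsRootVectorSystem e) {x x' y w : H.root}
    (hx : ρ x' = -ρ x) (hw : ρ w = ρ x + ρ y)
    (hsub : ∀ t, ρ t ≠ ρ y - ρ x) (hne : ρ y - ρ x ≠ 0) (hadd : ∀ t, ρ t ≠ ρ y + (2 : ℕ) • ρ x) :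
    structConst e x y * structConst e x' w = 1 := by
  have hli : LinearIndependent ℂ ![ρ x, ρ y] :=
    (IsKilling.rootSystem H).linearIndependent_of_add_mem_range_root' ⟨w, hw⟩
  have hbot : (IsKilling.rootSystem H).chainBotCoeff x y = 0 := by
    rw [RootPairing.chainBotCoeff_eq_zero_iff]
    exact .inr fun ⟨t, ht⟩ => hsub t ht
  have htop : (IsKilling.rootSystem H).chainTopCoeff x y = 1 := by
    have h1 := (RootPairing.root_add_nsmul_mem_range_iff_le_chainTopCoeff hli (n := 1)).1
      ⟨w, by rw [hw, one_smul, add_comm]⟩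
    have h2 := mt (RootPairing.root_add_nsmul_mem_range_iff_le_chainTopCoeff hli (n := 2)).2
      (fun ⟨t, ht⟩ => hadd t ht)
    omega
  have hpair : (IsKilling.rootSystem H).pairing y x = -1 := by
    have h1 := (IsKilling.rootSystem H).chainBotCoeff_sub_chainTopCoeff hli
    rw [hbot, htop] at h1
    rw [← (IsKilling.rootSystem H).algebraMap_pairingIn ℤ, ← h1]
    simp
  -- Expand `[e_{-x}, [e_x, e_y]]`: the term with `[e_{-x}, e_y]` vanishes because `y - x` is
  -- neither a root nor zero, and `[e_{-x}, e_x] = -h_x` acts on `e_y` by `1`, since the pairing of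
  -- `y` with the coroot of `x` is `-1`.
  have h1 := leibniz_lie (e x') (e x) (e y)
  have hlie : ⁅e x', e y⁆ = 0 := he.lie_eq_zero
    (fun t ht => hsub t (by rw [ht, hx]; abel)) (fun h => hne (by rw [← h, hx]; abel))
  have hc : ⁅e x', e x⁆ = -((IsKilling.rootSystem H).coroot x : L) := by
    rw [← he.lie_neg x x' hx, lie_skew]
  have hy : ⁅((IsKilling.rootSystem H).coroot x : L), e y⁆ = -e y := by
    have h2 := IsKilling.lie_eq_smul_of_mem_rootSpace (he.mem_rootSpace y)
      ((IsKilling.rootSystem H).coroot x)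
    have h3 : (y.1 : H → ℂ) ((IsKilling.rootSystem H).coroot x) = -1 := by
      rw [← hpair, IsKilling.rootSystem_pairing_apply]; rfl
    rw [h3, neg_one_smul] at h2
    exact h2
  rw [hlie, lie_zero, add_zero, hc, neg_lie, hy, neg_neg, lie_eq_structConst_smul he hw, lie_smul,
    lie_eq_structConst_smul he (t := y) (by rw [hw, hx]; abel), smul_smul] at h1
  exact smul_left_injective ℂ (he.ne_zero y) (h1.trans (one_smul ℂ _).symm)

end RootVectors

/-! ## Decimal codes of the positive roots -/

/-- The integer with decimal digits the coefficients of `v` in the order of comparison. -/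
def weight (v : Fin 6 → ℤ) : ℤ :=
  v 0 + 10 * v 2 + 100 * v 3 + 1000 * v 1 + 10000 * v 4 + 100000 * v 5

/-- The weights of the positive roots. -/
def codeList : List ℕ :=
  [1, 10, 11, 100, 110, 111, 1000, 1100, 1110, 1111, 10000, 10100, 10110, 10111, 11100, 
11110, 11111, 11210, 11211, 11221, 100000, 110000, 110100, 110110, 110111, 111100, 
111110, 111111, 111210, 111211, 111221, 121210, 121211, 121221, 121321, 122321]

/-- The weight of the positive root `r_{i+1}`. -/
def code (i : Fin 36) : ℕ := codeList.getD i 0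

/-- The index of the positive root of weight `n`, if there is one. -/
def index (n : ℕ) : Fin 36 := Fin.ofNat 36 (codeList.idxOf n)

theorem weight_add (v w : Fin 6 → ℤ) : weight (v + w) = weight v + weight w := by
  simp only [weight, Pi.add_apply]; ring

theorem weight_sub (v w : Fin 6 → ℤ) : weight (v - w) = weight v - weight w := by
  simp only [weight, Pi.sub_apply]; ring

theorem weight_neg (v : Fin 6 → ℤ) : weight (-v) = -weight v := by
  simp only [weight, Pi.neg_apply]; ring

/-- With signed digits of size at most 9, the leading nonzero digit outweighs all lower ones: `9 (1
+ 10 + ⋯ + 10^(m-1)) < 10^m`. So on such vectors the sign of the weight is the sign of the first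
nonzero coefficient. -/
theorem eq_zero_of_weight_eq_zero {v : Fin 6 → ℤ} (hv : ∀ k, |v k| ≤ 9) (h : weight v = 0) :
    v = 0 := by
  simp [abs_le, Fin.forall_fin_succ, weight] at hv h
  ext k
  fin_cases k <;> simp <;> omega

/-- The first nonzero coefficient of `v`, in the order of comparison, is positive. -/
def IsLexPos (v : Fin 6 → ℤ) : Prop :=
  ∃ m, 0 < v (comparisonOrder m) ∧ ∀ l < m, v (comparisonOrder l) = 0

theorem isLexPos_of_weight_pos {v : Fin 6 → ℤ} (hv : ∀ k, |v k| ≤ 9) (h : 0 < weight v) :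
    IsLexPos v := by
  simp [abs_le, Fin.forall_fin_succ, weight] at hv h
  by_contra hn
  simp [IsLexPos, comparisonOrder, Fin.exists_fin_succ, Fin.forall_fin_succ] at hn
  omega

theorem weight_posCoeff : ∀ i, weight (posCoeff i) = code i := by decide +kernel

theorem posCoeff_bounds : ∀ i k, 0 ≤ posCoeff i k ∧ posCoeff i k ≤ 3 := by decide +kernel

theorem code_lt_code : ∀ j, ∀ i < j, code i < code j := by decide +kernel

theorem code_pos : ∀ i, 0 < code i := by decide +kernel

theorem index_code : ∀ i, index (code i) = i := by decide +kernel

theorem code_injective : Function.Injective code := fun i j h => by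
  rw [← index_code i, h, index_code]

theorem lt_of_code_lt {i j : Fin 36} (h : code i < code j) : i < j := by
  by_contra hn
  rcases (not_lt.1 hn).eq_or_lt with rfl | h'
  · exact h.false
  · exact (code_lt_code _ _ h').not_gt h

theorem posCoeff_add_eq_iff {i j k : Fin 36} :
    posCoeff i + posCoeff j = posCoeff k ↔ code i + code j = code k := by
  constructor
  · intro h
    have := congrArg weight h
    simp only [weight_add, weight_posCoeff] at this
    exact_mod_cast this
  · intro h
    rw [← sub_eq_zero]
    refine eq_zero_of_weight_eq_zero (fun m => ?_) ?_
    · have h1 := posCoeff_bounds i m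
      have h2 := posCoeff_bounds j m
      have h3 := posCoeff_bounds k m
      simp only [Pi.sub_apply, Pi.add_apply, abs_le]
      omega
    · simp only [weight_add, weight_sub, weight_posCoeff]
      omega

theorem isLexPos_posCoeff (i : Fin 36) : IsLexPos (posCoeff i) := by
  refine isLexPos_of_weight_pos (fun m => ?_) ?_
  · have h1 := posCoeff_bounds i m
    rw [abs_le]; omega
  · have := code_pos i
    rw [weight_posCoeff]; omega

theorem isLexPos_posCoeff_sub {i j : Fin 36} (h : i < j) :
    IsLexPos (posCoeff j - posCoeff i) := by
  refine isLexPos_of_weight_pos (fun m => ?_) ?_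
  · have h1 := posCoeff_bounds i m
    have h2 := posCoeff_bounds j m
    rw [Pi.sub_apply, abs_le]; omega
  · have := code_lt_code _ _ h
    rw [weight_sub, weight_posCoeff, weight_posCoeff]; omega

/-! ## The norm form and the simple reflections -/

/-- Half of the quadratic form defined by the Cartan matrix of type `E₆`. -/
def normForm (v : Fin 6 → ℤ) : ℤ :=
  v 0 ^ 2 + v 1 ^ 2 + v 2 ^ 2 + v 3 ^ 2 + v 4 ^ 2 + v 5 ^ 2 -
    (v 0 * v 2 + v 2 * v 3 + v 1 * v 3 + v 3 * v 4 + v 4 * v 5)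

theorem normForm_posCoeff : ∀ i, normForm (posCoeff i) = 1 := by decide +kernel

/-- The value on the `k`-th simple coroot of the element with coefficients `v`. -/
def corootValue (k : Fin 6) (v : Fin 6 → ℤ) : ℤ := ∑ i, v i * CartanMatrix.E₆ i k

/-- The reflection in the `k`-th simple root. -/
def simpleReflection (k : Fin 6) (v : Fin 6 → ℤ) : Fin 6 → ℤ :=
  v - corootValue k v • Pi.single k 1

/-- The weights of the simple roots. -/
def simpleCode : Fin 6 → ℤ := ![1, 1000, 10, 100, 10000, 100000]

theorem weight_simpleReflection (k : Fin 6) (v : Fin 6 → ℤ) :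
    weight (simpleReflection k v) = weight v - corootValue k v * simpleCode k := by
  rw [simpleReflection, weight_sub]
  congr 1
  fin_cases k <;> simp [weight, simpleCode] <;> ring

theorem corootValue_bounds : ∀ k i, |corootValue k (posCoeff i)| ≤ 2 := by decide +kernel

theorem abs_simpleReflection_le (k : Fin 6) (i : Fin 36) (m : Fin 6) :
    |simpleReflection k (posCoeff i) m| ≤ 5 := by
  have h1 := posCoeff_bounds i m
  have h2 := corootValue_bounds k i
  rw [abs_le] at h2
  by_cases h : m = k
  · subst h
    simp only [simpleReflection, Pi.sub_apply, Pi.smul_apply, Pi.single_eq_same, smul_eq_mul,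
      mul_one, abs_le]
    omega
  · simp only [simpleReflection, Pi.sub_apply, Pi.smul_apply, Pi.single_eq_of_ne h, smul_zero,
      abs_le]
    omega

/-- Closure of the listed roots and their negatives under simple reflections, in terms of weights.
The bound 5 on reflected coefficients lets the equality of weights be lifted back to vectors. -/
theorem weight_simpleReflection_posCoeff : ∀ k i, ∃ j,
    (code i : ℤ) - corootValue k (posCoeff i) * simpleCode k = code j ∨
    (code i : ℤ) - corootValue k (posCoeff i) * simpleCode k = -code j := by decide +kernel

theorem simpleReflection_posCoeff (k : Fin 6) (i : Fin 36) : ∃ j,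
    simpleReflection k (posCoeff i) = posCoeff j ∨
    simpleReflection k (posCoeff i) = -posCoeff j := by
  obtain ⟨j, h⟩ := weight_simpleReflection_posCoeff k i
  refine ⟨j, h.imp (fun h => ?_) (fun h => ?_)⟩
  · rw [← sub_eq_zero]
    refine eq_zero_of_weight_eq_zero (fun m => ?_) ?_
    · have h1 := posCoeff_bounds j m
      have h2 := abs_simpleReflection_le k i m
      rw [abs_le] at h2
      rw [Pi.sub_apply, abs_le]; omega
    · rw [weight_sub, weight_simpleReflection, weight_posCoeff, weight_posCoeff, h, sub_self]
  · rw [← sub_eq_zero]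
    refine eq_zero_of_weight_eq_zero (fun m => ?_) ?_
    · have h1 := posCoeff_bounds j m
      have h2 := abs_simpleReflection_le k i m
      rw [abs_le] at h2
      rw [Pi.sub_apply, Pi.neg_apply, abs_le]; omega
    · rw [weight_sub, weight_neg, weight_simpleReflection, weight_posCoeff, weight_posCoeff, h,
        sub_self]

theorem exists_posCoeff_eq_single : ∀ k, ∃ i, posCoeff i = Pi.single k 1 := by decide +kernel

/-- The condition `j < i` makes this the step of an induction showing that every listed vector
really is a root. -/
theorem code_eq_simpleCode_or_reflection : ∀ i, (∃ k, posCoeff i = Pi.single k 1) ∨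
    ∃ k, ∃ j < i, (code j : ℤ) - corootValue k (posCoeff j) * simpleCode k = code i := by
  decide +kernel

theorem posCoeff_eq_single_or_reflection (i : Fin 36) : (∃ k, posCoeff i = Pi.single k 1) ∨
    ∃ k, ∃ j < i, simpleReflection k (posCoeff j) = posCoeff i := by
  refine (code_eq_simpleCode_or_reflection i).imp_right ?_
  rintro ⟨k, j, hj, h⟩
  refine ⟨k, j, hj, ?_⟩
  rw [← sub_eq_zero]
  refine eq_zero_of_weight_eq_zero (fun m => ?_) ?_
  · have h1 := posCoeff_bounds i m
    have h2 := abs_simpleReflection_le k j m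
    rw [abs_le] at h2
    rw [Pi.sub_apply, abs_le]; omega
  · rw [weight_sub, weight_simpleReflection, weight_posCoeff, weight_posCoeff, h, sub_self]

/-! ## Relations between the entries of the tables -/

theorem positiveTable_swap : ∀ i j, positiveTable i j = -positiveTable j i := by decide +kernel

/-- A number that is not a code has `index` equal to the default `0`, so `code (index n) = n` tests
whether `n` is the code of a positive root. The value `0` produced by truncated subtraction fails
this test, as `code 0 = 1`. -/
theorem positiveTable_eq_zero_or : ∀ i j,
    positiveTable i j = 0 ∨ code (index (code i + code j)) = code i + code j := by decide +kernel

theorem mixedTable_eq_zero_or : ∀ i j, mixedTable i j = 0 ∨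
    code j + code (index (code i - code j)) = code i ∨
    code i + code (index (code j - code i)) = code j := by decide +kernel

/-- These are the relations that the second identity for structure constants forces between the two
tables. -/
theorem tables_of_code_add : ∀ i j, code (index (code i + code j)) ≠ code i + code j ∨
    (positiveTable i j = 1 ∨ positiveTable i j = -1) ∧
    mixedTable (index (code i + code j)) i = -positiveTable i j ∧
    mixedTable i (index (code i + code j)) = positiveTable j i := by decide +kernel

theorem tables_of_add {i j k : Fin 36} (h : code i + code j = code k) :
    (positiveTable i j = 1 ∨ positiveTable i j = -1) ∧
    mixedTable k i = -positiveTable i j ∧ mixedTable i k = positiveTable j i := by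
  have := tables_of_code_add i j
  rw [h, index_code] at this
  exact this.resolve_left (fun h => h rfl)

/-- The first positive root that can be subtracted from the root of weight `n`, leaving a
positive root. -/
def leastSummand (n : ℕ) : Fin 36 :=
  ((List.finRange 36).find? fun i => code (index (n - code i)) == n - code i).getD 0

/-- `r_{i+1} + r_{j+1}` is the sum of an extraspecial pair with first member `r_{i+1}`. -/
def IsLeastSummand (i j : Fin 36) : Prop :=
  i < j ∧ ∀ i' < i, code (index (code i + code j - code i')) ≠ code i + code j - code i'

instance (i j : Fin 36) : Decidable (IsLeastSummand i j) := by
  unfold IsLeastSummand; infer_instance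

/-- The entry `(i, j)` of the table of positive roots is at an extraspecial pair, or is determined
by the Jacobi identity for `i₀, q, j`, where `i₀, j₀` is the extraspecial pair with the same sum,
`i = i₀ + q` and `j₀ = q + j`. -/
def IsDetermined (i j : Fin 36) : Prop :=
  let i₀ := leastSummand (code i + code j)
  let j₀ := index (code i + code j - code i₀)
  let q := index (code i - code i₀)
  code i₀ + code j₀ = code i + code j ∧ IsLeastSummand i₀ j₀ ∧ positiveTable i₀ j₀ = 1 ∧
    (i = i₀ ∨ code i₀ + code q = code i ∧ code q + code j = code j₀ ∧
      positiveTable q j = positiveTable i₀ q * positiveTable i j)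

instance (i j : Fin 36) : Decidable (IsDetermined i j) := by
  unfold IsDetermined; infer_instance

/-- If roots have squared length 2, then `i₀` has inner product 1 with the root `i + j`. When `i₀`
differs from `i` and `j`, it therefore has inner product 1 with one of them and 0 with the other. It
can be subtracted from the former, and minimality of `i₀` makes the difference positive. -/
theorem isDetermined_or : ∀ i j, positiveTable i j = 0 ∨ IsDetermined i j ∨ IsDetermined j i := by
  decide +kernel

/-- A function on pairs of positive roots that is antisymmetric, satisfies the Jacobi identity and
is `1` at the extraspecial pairs is given by the table. -/
theorem eq_positiveTable_of_add {N : Fin 36 → Fin 36 → ℂ} (hswap : ∀ i j, N i j = -N j i)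
    (hjacobi : ∀ x y z u v w, code x + code y = code u → code y + code z = code v →
      code x + code v = code w → N y z * N x v = N x y * N u z)
    (hspecial : ∀ i j k, code i + code j = code k → IsLeastSummand i j → N i j = 1)
    (i j k : Fin 36) (h : code i + code j = code k) : N i j = positiveTable i j := by
  induction k using WellFoundedLT.induction generalizing i j with
  | _ k ih => ?_
  have key : ∀ i j, code i + code j = code k → IsDetermined i j → N i j = positiveTable i j := by
    intro i j h hd
    obtain ⟨hsum, hleast, h1, hd⟩ := hd
    set i₀ := leastSummand (code i + code j)
    set j₀ := index (code i + code j - code i₀)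
    set q := index (code i - code i₀)
    rw [h] at hsum
    have hN := hspecial i₀ j₀ k hsum hleast
    rcases hd with hi | ⟨hq, hqj, hT⟩
    · have hj : j = j₀ := code_injective (by rw [← hi] at hsum; omega)
      rw [hi, hj, hN, h1, Int.cast_one]
    -- As `N i₀ j₀ = 1`, the identity reads `N q j = N i₀ q * N i j`. Both other constants have sums
    -- `j₀` and `i` below `k`, so the induction hypothesis applies, and `N i₀ q = ±1` can be
    -- cancelled.
    · have hJ := hjacobi i₀ q j i j₀ k hq hqj hsum
      have hlt : i < k := lt_of_code_lt (by have := code_pos j; omega)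
      have hlt₀ : j₀ < k := lt_of_code_lt (by have := code_pos i₀; omega)
      rw [hN, ih j₀ hlt₀ q j hqj, ih i hlt i₀ q hq, hT, mul_one, Int.cast_mul] at hJ
      refine (mul_left_cancel₀ ?_ hJ).symm
      rcases (tables_of_add hq).1 with h | h <;> simp [h]
  rcases isDetermined_or i j with h0 | hd | hd
  · rcases (tables_of_add h).1 with h' | h' <;> simp [h'] at h0
  · exact key i j h hd
  · rw [hswap, key j i (by omega) hd, positiveTable_swap i j, Int.cast_neg]

/-! ### Integral combinations of the fundamental roots, and extraspecial pairs in terms of codes. -/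

section Combination

variable {V : Type*} [AddCommGroup V] {α : Fin 6 → V}

/-- The element with coefficients `v` with respect to the fundamental roots `α`. -/
def combination (α : Fin 6 → V) (v : Fin 6 → ℤ) : V := ∑ k, v k • α k

theorem combination_add (v w : Fin 6 → ℤ) :
    combination α (v + w) = combination α v + combination α w := by
  simp [combination, add_smul, Finset.sum_add_distrib]

theorem combination_sub (v w : Fin 6 → ℤ) :
    combination α (v - w) = combination α v - combination α w := by
  simp [combination, sub_smul, Finset.sum_sub_distrib]

theorem combination_neg (v : Fin 6 → ℤ) : combination α (-v) = -combination α v := by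
  simp [combination]

theorem combination_zsmul (n : ℤ) (v : Fin 6 → ℤ) :
    combination α (n • v) = n • combination α v := by
  simp [combination, Finset.smul_sum, smul_smul]

theorem combination_nsmul (n : ℕ) (v : Fin 6 → ℤ) :
    combination α (n • v) = n • combination α v := by
  simpa using combination_zsmul (α := α) n v

theorem combination_single (k : Fin 6) : combination α (Pi.single k 1) = α k := by
  simp [combination, Pi.single_apply]

variable [Module ℂ V]

theorem posRoot_eq_combination (α : Fin 6 → V) (i : Fin 36) :
    posRoot α i = combination α (posCoeff i) := rfl

theorem combination_injective (hα : LinearIndependent ℂ α) :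
    Function.Injective (combination α) := by
  intro v w h
  rw [← sub_eq_zero, ← combination_sub] at h
  funext k
  have := Fintype.linearIndependent_iff.1 hα (fun k => ((v - w) k : ℂ))
    (by simpa only [combination, Int.cast_smul_eq_zsmul] using h) k
  rw [Int.cast_eq_zero, Pi.sub_apply, sub_eq_zero] at this
  exact this

theorem prec_of_isLexPos {x y : V} {v : Fin 6 → ℤ} (hv : IsLexPos v)
    (h : y - x = combination α v) : Prec α x y := by
  obtain ⟨m, hm, hl⟩ := hv
  refine ⟨fun k => v k, ?_, m, Int.cast_pos.2 hm, fun l hlm => Int.cast_eq_zero.2 (hl l hlm)⟩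
  simpa [combination, Int.cast_smul_eq_zsmul] using h

theorem not_prec_zero_neg_posRoot (hα : LinearIndependent ℂ α) (i : Fin 36) :
    ¬ Prec α 0 (-posRoot α i) := by
  rintro ⟨τ, h, m, hm, -⟩
  -- The coefficients `τ` are only known to be real; independence over `ℂ` forces `τ = -posCoeff i`,
  -- which has no positive entry.
  have h0 : ∑ k, ((τ k : ℂ) + posCoeff i k) • α k = 0 := by
    simp only [add_smul, Finset.sum_add_distrib, ← h, Int.cast_smul_eq_zsmul]
    simp [posRoot]
  have h1 := Fintype.linearIndependent_iff.1 hα _ h0 (comparisonOrder m)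
  have h2 : τ (comparisonOrder m) + posCoeff i (comparisonOrder m) = 0 := by exact_mod_cast h1
  have h3 : (0 : ℝ) ≤ posCoeff i (comparisonOrder m) := by
    exact_mod_cast (posCoeff_bounds i _).1
  linarith

theorem posRoot_add_eq_iff (hα : LinearIndependent ℂ α) {i j k : Fin 36} :
    posRoot α i + posRoot α j = posRoot α k ↔ code i + code j = code k := by
  simp only [posRoot_eq_combination, ← combination_add, (combination_injective hα).eq_iff,
    posCoeff_add_eq_iff]

/-- A pair of positive roots is extraspecial as soon as no positive root preceding its first member
is a summand of its sum. -/
theorem isExtraspecial_of_isLeastSummand (hα : LinearIndependent ℂ α) {Φ : Set V}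
    (hΦ : Φ = Set.range (posRoot α) ∪ Set.range fun i => -posRoot α i) {i j k : Fin 36}
    (h : code i + code j = code k) (hij : IsLeastSummand i j) :
    IsExtraspecial Φ α (posRoot α i) (posRoot α j) := by
  obtain ⟨hlt, hleast⟩ := hij
  have hk := (posRoot_add_eq_iff hα).2 h
  refine ⟨⟨?_, ?_, ?_, ?_, ?_⟩, ?_⟩
  · exact hΦ ▸ .inl ⟨i, rfl⟩
  · exact hΦ ▸ .inl ⟨j, rfl⟩
  · exact hΦ ▸ .inl ⟨k, hk.symm⟩
  · exact prec_of_isLexPos (isLexPos_posCoeff i) (sub_zero _)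
  · exact prec_of_isLexPos (isLexPos_posCoeff_sub hlt) (combination_sub _ _).symm
  · rintro r' s' ⟨hr, hs, -, h0, -⟩ hsum
    rw [hΦ] at hr hs
    obtain ⟨i', rfl⟩ | ⟨i', rfl⟩ := hr
    · rcases lt_trichotomy i i' with hi | rfl | hi
      · exact .inr (prec_of_isLexPos (isLexPos_posCoeff_sub hi) (combination_sub _ _).symm)
      · exact .inl rfl
      · exfalso
        rw [hk] at hsum
        obtain ⟨l, rfl⟩ | ⟨l, rfl⟩ := hs
        · have := (posRoot_add_eq_iff hα).1 hsum
          refine hleast i' hi ?_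
          rw [h, show code k - code i' = code l by omega, index_code]
        -- If `s'` were negative, `r'` would be the sum of `r_{k+1}` and a positive root, hence of
        -- larger code than `r_{i+1}`, although `i' < i`.
        · have := (posRoot_add_eq_iff hα).1 (eq_add_of_add_neg_eq hsum).symm
          have := code_lt_code _ _ hi
          omega
    · exact absurd h0 (not_prec_zero_neg_posRoot hα i')

end Combination

/-! ### Determination of the root system, and the consequences of equal root lengths. -/

section Roots

variable {L : Type*} [LieRing L] [LieAlgebra ℂ L] [FiniteDimensional ℂ L]
  [LieAlgebra.IsKilling ℂ L] {H : LieSubalgebra ℂ L} [H.IsCartanSubalgebra]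
  {e : H.root → L} {α : Fin 6 → Module.Dual ℂ H}

local notation "ρ" => RootPairing.root (IsKilling.rootSystem H)

section Base

variable (B : (IsKilling.rootSystem H).Base) (ν : Fin 6 ≃ B.support)
  (hE₆ : ∀ i j, B.cartanMatrix (ν i) (ν j) = CartanMatrix.E₆ i j)
  (hα : ∀ k, α k = (IsKilling.rootSystem H).root (ν k))

include hα in
theorem linearIndependent_simple : LinearIndependent ℂ α := by
  have h : LinearIndependent ℂ fun j : B.support => ρ j := B.linearIndepOn_root
  rw [show α = (fun j : B.support => ρ j) ∘ ν from funext hα]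
  exact h.comp _ ν.injective

include hE₆ hα

theorem reflection_combination (k : Fin 6) (v : Fin 6 → ℤ) :
    (IsKilling.rootSystem H).reflection (ν k) (combination α v) =
      combination α (simpleReflection k v) := by
  have h : ∀ i, (IsKilling.rootSystem H).reflection (ν k) (α i) =
      α i - CartanMatrix.E₆ i k • α k := by
    intro i
    rw [hα i, hα k, RootPairing.reflection_apply_root, ← hE₆,
      ← Int.cast_smul_eq_zsmul ℂ (B.cartanMatrix (ν i) (ν k))]
    congr 2
    exact (B.algebraMap_cartanMatrixIn_apply ℤ (ν i) (ν k)).symm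
  rw [simpleReflection, combination_sub, combination_zsmul, combination_single]
  simp only [combination, map_sum, map_zsmul, h, smul_sub, Finset.sum_sub_distrib, smul_smul,
    corootValue, Finset.sum_smul]

/-- Every root arises from the simple roots by simple reflections, and the list with its negatives
contains the former and is stable under the latter. -/
theorem root_eq_posRoot_or_neg (r : H.root) : ∃ i, ρ r = posRoot α i ∨ ρ r = -posRoot α i := by
  refine B.induction_reflect r
    (p := fun r => ∃ i, ρ r = posRoot α i ∨ ρ r = -posRoot α i) ?_ ?_ ?_
  · rintro r ⟨i, h⟩
    refine ⟨i, ?_⟩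
    rw [RootPairing.root_reflectionPerm, RootPairing.reflection_apply_self, neg_inj,
      neg_eq_iff_eq_neg]
    exact h.symm
  · intro r hr
    obtain ⟨k, hk⟩ := ν.surjective ⟨r, hr⟩
    obtain ⟨i, hi⟩ := exists_posCoeff_eq_single k
    exact ⟨i, .inl (by rw [posRoot_eq_combination, hi, combination_single, hα, hk])⟩
  · rintro r s ⟨i, h⟩ hs
    obtain ⟨k, hk⟩ := ν.surjective ⟨s, hs⟩
    obtain rfl : s = ν k := by rw [hk]
    obtain ⟨j, hj⟩ := simpleReflection_posCoeff k i
    refine ⟨j, ?_⟩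
    simp only [RootPairing.root_reflectionPerm, posRoot_eq_combination] at h ⊢
    rcases h with h | h <;> rcases hj with hj | hj <;>
      simp [h, reflection_combination B ν hE₆ hα, hj, combination_neg]

theorem exists_root_eq_posRoot (i : Fin 36) : ∃ r, ρ r = posRoot α i := by
  induction i using WellFoundedLT.induction with
  | ind i ih =>
    rcases posCoeff_eq_single_or_reflection i with ⟨k, hk⟩ | ⟨k, j, hj, h⟩
    · exact ⟨ν k, by rw [posRoot_eq_combination, hk, combination_single, hα]⟩
    · obtain ⟨r, hr⟩ := ih j hj
      refine ⟨(IsKilling.rootSystem H).reflectionPerm (ν k) r, ?_⟩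
      rw [RootPairing.root_reflectionPerm, hr, posRoot_eq_combination,
        reflection_combination B ν hE₆ hα, h, posRoot_eq_combination]

theorem range_root : Set.range ρ = Set.range (posRoot α) ∪ Set.range fun i => -posRoot α i := by
  ext x
  constructor
  · rintro ⟨r, rfl⟩
    obtain ⟨i, h | h⟩ := root_eq_posRoot_or_neg B ν hE₆ hα r
    · exact .inl ⟨i, h.symm⟩
    · exact .inr ⟨i, h.symm⟩
  · rintro (⟨i, rfl⟩ | ⟨i, rfl⟩)
    · exact exists_root_eq_posRoot B ν hE₆ hα i
    · obtain ⟨r, hr⟩ := exists_root_eq_posRoot B ν hE₆ hα i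
      exact ⟨(IsKilling.rootSystem H).reflectionPerm r r, by
        rw [RootPairing.root_reflectionPerm, RootPairing.reflection_apply_self, hr]⟩

end Base

theorem normForm_neg (v : Fin 6 → ℤ) : normForm (-v) = normForm v := by
  simp [normForm]

theorem exists_combination_eq_root (hroot : ∀ r, ∃ i, ρ r = posRoot α i ∨ ρ r = -posRoot α i)
    (r : H.root) : ∃ v, ρ r = combination α v ∧ normForm v = 1 := by
  obtain ⟨i, h | h⟩ := hroot r
  · exact ⟨_, h, normForm_posCoeff i⟩
  · exact ⟨-posCoeff i, by rw [h, combination_neg, posRoot_eq_combination],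
      by rw [normForm_neg, normForm_posCoeff]⟩

variable (hli : LinearIndependent ℂ α)
  (hroot : ∀ r, ∃ i, (IsKilling.rootSystem H).root r = posRoot α i ∨
    (IsKilling.rootSystem H).root r = -posRoot α i)

include hli hroot

theorem normForm_eq_one {r : H.root} {v : Fin 6 → ℤ} (h : ρ r = combination α v) :
    normForm v = 1 := by
  obtain ⟨w, hw, h1⟩ := exists_combination_eq_root hroot r
  rw [combination_injective hli (h.symm.trans hw), h1]

theorem structConst_jacobi_of_roots (he : IsRootVectorSystem e) {x y z u v w : H.root}
    (hu : ρ u = ρ x + ρ y) (hv : ρ v = ρ y + ρ z) (hw : ρ w = ρ x + ρ y + ρ z) :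
    structConst e y z * structConst e x v = structConst e x y * structConst e u z := by
  obtain ⟨a, ha, qa⟩ := exists_combination_eq_root hroot x
  obtain ⟨b, hb, qb⟩ := exists_combination_eq_root hroot y
  obtain ⟨c, hc, qc⟩ := exists_combination_eq_root hroot z
  have qu := normForm_eq_one hli hroot (v := a + b) (by rw [hu, ha, hb, combination_add])
  have qv := normForm_eq_one hli hroot (v := b + c) (by rw [hv, hb, hc, combination_add])
  have qw := normForm_eq_one hli hroot (v := a + b + c)
    (by rw [hw, ha, hb, hc, combination_add, combination_add])
  -- For a quadratic form `q`, `q(a+b+c) = q(a+b) + q(b+c) + q(a+c) - q(a) - q(b) - q(c)`. The value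
  -- 2 excludes both a root (value 1) and zero.
  have hq : normForm (a + c) = 2 := by
    simp only [normForm, Pi.add_apply] at *
    linear_combination qw - qu - qv + qa + qb + qc
  refine structConst_jacobi he hu hv hw (fun t ht => ?_) (fun h => ?_)
  · rw [normForm_eq_one hli hroot (r := t) (by rw [ht, ha, hc, combination_add])] at hq
    norm_num at hq
  · rw [ha, hc, ← combination_add, ← sub_self (combination α 0), ← combination_sub, sub_self] at h
    rw [combination_injective hli h] at hq
    simp [normForm] at hq

theorem structConst_mul_structConst_neg_of_roots (he : IsRootVectorSystem e)
    {x x' y w : H.root} (hx : ρ x' = -ρ x) (hw : ρ w = ρ x + ρ y) :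
    structConst e x y * structConst e x' w = 1 := by
  obtain ⟨a, ha, qa⟩ := exists_combination_eq_root hroot x
  obtain ⟨b, hb, qb⟩ := exists_combination_eq_root hroot y
  have qw := normForm_eq_one hli hroot (v := a + b) (by rw [hw, ha, hb, combination_add])
  -- The parallelogram law for `a, b`, and below for `a + b, a`: the value 3 shows that the
  -- `x`-chain through `y` is just `y, x + y`.
  have hsub : normForm (b - a) = 3 := by
    simp only [normForm, Pi.add_apply, Pi.sub_apply] at *
    linear_combination 2 * qa + 2 * qb - qw
  have hadd : normForm (b + 2 • a) = 3 := by
    rw [two_nsmul]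
    simp only [normForm, Pi.add_apply] at *
    linear_combination 2 * qw + 2 * qa - qb
  refine structConst_mul_structConst_neg he hx hw (fun t ht => ?_) (fun h => ?_) (fun t ht => ?_)
  · rw [normForm_eq_one hli hroot (r := t) (by rw [ht, ha, hb, combination_sub])] at hsub
    norm_num at hsub
  · rw [ha, hb, ← combination_sub, ← sub_self (combination α 0), ← combination_sub, sub_self] at h
    rw [combination_injective hli h] at hsub
    simp [normForm] at hsub
  · rw [normForm_eq_one hli hroot (r := t)
      (by rw [ht, ha, hb, combination_add, combination_nsmul])] at hadd
    norm_num at hadd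

end Roots

/-! ### Identification of all structure constants with the table entries. -/

section Tables

variable {L : Type*} [LieRing L] [LieAlgebra ℂ L] [FiniteDimensional ℂ L]
  [LieAlgebra.IsKilling ℂ L] {H : LieSubalgebra ℂ L} [H.IsCartanSubalgebra]
  {e : H.root → L} {α : Fin 6 → Module.Dual ℂ H}

local notation "ρ" => RootPairing.root (IsKilling.rootSystem H)

variable (hli : LinearIndependent ℂ α)
  (hΦ : Set.range (IsKilling.rootSystem H).root =
    Set.range (posRoot α) ∪ Set.range fun i => -posRoot α i)

include hΦ

theorem root_eq_posRoot_or_neg_of_range (r : H.root) :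
    ∃ i, ρ r = posRoot α i ∨ ρ r = -posRoot α i := by
  obtain ⟨i, h⟩ | ⟨i, h⟩ : ρ r ∈ Set.range (posRoot α) ∪ Set.range fun i => -posRoot α i :=
    hΦ ▸ ⟨r, rfl⟩
  · exact ⟨i, .inl h.symm⟩
  · exact ⟨i, .inr h.symm⟩

theorem exists_root_eq_neg_posRoot_of_range (i : Fin 36) : ∃ r, ρ r = -posRoot α i := by
  have h : -posRoot α i ∈ Set.range ρ := hΦ ▸ .inr ⟨i, rfl⟩
  exact h

theorem exists_root_eq_posRoot_of_range (i : Fin 36) : ∃ r, ρ r = posRoot α i := by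
  have h : posRoot α i ∈ Set.range ρ := hΦ ▸ .inl ⟨i, rfl⟩
  exact h

include hli

theorem structConst_posRoot (he : IsRootVectorSystem e)
    (hN : ∀ r s : H.root, IsExtraspecial (Set.range ρ) α (ρ r) (ρ s) → structConst e r s = 1)
    {r s : H.root} {i j : Fin 36} (hr : ρ r = posRoot α i) (hs : ρ s = posRoot α j) :
    structConst e r s = positiveTable i j := by
  have hroot := root_eq_posRoot_or_neg_of_range hΦ
  by_cases h : ∃ k, code i + code j = code k
  · obtain ⟨k, hk⟩ := h
    choose R hR using exists_root_eq_posRoot_of_range hΦ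
    have key := eq_positiveTable_of_add (N := fun i j => structConst e (R i) (R j))
      (fun i j => structConst_swap he _ _) ?_ ?_ i j k hk
    · rwa [(IsKilling.rootSystem H).root.injective (hr.trans (hR i).symm),
        (IsKilling.rootSystem H).root.injective (hs.trans (hR j).symm)]
    · intro x y z u v w hu hv hw
      rw [← posRoot_add_eq_iff hli] at hu hv hw
      refine structConst_jacobi_of_roots hli hroot he (w := R w) ?_ ?_ ?_
      · rw [hR, hR, hR, hu]
      · rw [hR, hR, hR, hv]
      · rw [hR, hR, hR, hR, ← hw, ← hv, add_assoc]
    · intro i j k hk hij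
      refine hN _ _ ?_
      rw [hR, hR]
      exact isExtraspecial_of_isLeastSummand hli hΦ hk hij
  · have h0 : positiveTable i j = 0 :=
      (positiveTable_eq_zero_or i j).resolve_right fun h' => h ⟨_, h'.symm⟩
    rw [h0, Int.cast_zero]
    refine structConst_eq_zero fun t ht => ?_
    rw [hr, hs] at ht
    obtain ⟨k, hk | hk⟩ := hroot t
    · exact h ⟨k, (posRoot_add_eq_iff hli).1 (ht.symm.trans hk)⟩
    -- A sum of two positive roots has positive weight, so it is not a negative root.
    · rw [hk] at ht
      simp only [posRoot_eq_combination, ← combination_add, ← combination_neg] at ht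
      have := congrArg weight (combination_injective hli ht)
      simp only [weight_add, weight_neg, weight_posCoeff] at this
      have := code_pos i
      omega

/-- All structure constants at the pairs formed from `r`, `s`, `t` and their negatives are
determined by `N_{s,t}` when `s + t = r`. -/
theorem structConst_of_add (he : IsRootVectorSystem e) {r s t r' s' t' : H.root} {c : ℂ}
    (hr : ρ r' = -ρ r) (hs : ρ s' = -ρ s) (ht : ρ t' = -ρ t) (h : ρ r = ρ s + ρ t)
    (hst : structConst e s t = c) (hc : c * c = 1) :
    structConst e r s' = -c ∧ structConst e t r' = c ∧ structConst e t' s' = c := by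
  have hroot := root_eq_posRoot_or_neg_of_range hΦ
  have hc0 : c ≠ 0 := left_ne_zero_of_mul_eq_one hc
  have h1 := structConst_mul_structConst_neg_of_roots hli hroot he hs h
  -- Since `c * c = 1`, each relation `c * N = 1` gives `N = c`. The relation is used for `(s, t)`,
  -- then `(r, -s)`, then `(t, -r)`, each time feeding in the constant just found.
  rw [hst, ← hc, mul_right_inj' hc0] at h1
  have h2 : structConst e r s' = -c := by rw [structConst_swap he, h1]
  have h3 := structConst_mul_structConst_neg_of_roots hli hroot he (y := s') (w := t) hr
    (by rw [hs, h]; abel)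
  rw [h2, ← hc, neg_mul, ← mul_neg, mul_right_inj' hc0, neg_eq_iff_eq_neg] at h3
  have h4 : structConst e t r' = c := by rw [structConst_swap he, h3, neg_neg]
  have h5 := structConst_mul_structConst_neg_of_roots hli hroot he (y := r') (w := s') ht
    (by rw [hs, hr, h]; abel)
  rw [h4, ← hc, mul_right_inj' hc0] at h5
  exact ⟨h2, h4, h5⟩

variable (he : IsRootVectorSystem e)
  (hpos : ∀ (r s : H.root) (i j : Fin 36), (IsKilling.rootSystem H).root r = posRoot α i →
    (IsKilling.rootSystem H).root s = posRoot α j → structConst e r s = positiveTable i j)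

include he hpos

theorem structConst_tables_of_add {i j k : Fin 36} (h : code i + code j = code k)
    {r s t r' s' t' : H.root} (hr : ρ r = posRoot α k) (hs : ρ s = posRoot α i)
    (ht : ρ t = posRoot α j) (hr' : ρ r' = -posRoot α k) (hs' : ρ s' = -posRoot α i)
    (ht' : ρ t' = -posRoot α j) :
    structConst e r s' = mixedTable k i ∧ structConst e t r' = mixedTable j k ∧
      structConst e t' s' = -positiveTable j i := by
  obtain ⟨h1, h2, -⟩ := tables_of_add h
  have h3 := (tables_of_add (show code j + code i = code k by omega)).2.2
  have := structConst_of_add hli hΦ he (hr'.trans (by rw [hr])) (hs'.trans (by rw [hs]))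
    (ht'.trans (by rw [ht])) (by rw [hr, hs, ht, (posRoot_add_eq_iff hli).2 h])
    (hpos s t i j hs ht) (by rcases h1 with h | h <;> simp [h])
  rw [h2, h3, positiveTable_swap j i]
  push_cast
  rwa [neg_neg]

/-- The difference of the two positive roots is a positive root, a negative root, or no root; the
first two cases are the first two conclusions of `structConst_tables_of_add`. -/
theorem structConst_posRoot_neg {r s : H.root} {i j : Fin 36} (hr : ρ r = posRoot α i)
    (hs : ρ s = -posRoot α j) : structConst e r s = mixedTable i j := by
  have hroot := root_eq_posRoot_or_neg_of_range hΦ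
  by_cases h1 : ∃ k, code j + code k = code i
  · obtain ⟨k, hk⟩ := h1
    obtain ⟨r', hr'⟩ := exists_root_eq_neg_posRoot_of_range hΦ i
    obtain ⟨s', hs'⟩ := exists_root_eq_posRoot_of_range hΦ j
    obtain ⟨t, ht⟩ := exists_root_eq_posRoot_of_range hΦ k
    obtain ⟨t', ht'⟩ := exists_root_eq_neg_posRoot_of_range hΦ k
    exact (structConst_tables_of_add hli hΦ he hpos hk hr hs' ht hr' hs ht').1
  by_cases h2 : ∃ k, code k + code i = code j
  · obtain ⟨k, hk⟩ := h2
    obtain ⟨r', hr'⟩ := exists_root_eq_neg_posRoot_of_range hΦ i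
    obtain ⟨s', hs'⟩ := exists_root_eq_posRoot_of_range hΦ j
    obtain ⟨t, ht⟩ := exists_root_eq_posRoot_of_range hΦ k
    obtain ⟨t', ht'⟩ := exists_root_eq_neg_posRoot_of_range hΦ k
    exact (structConst_tables_of_add hli hΦ he hpos hk hs' ht hr hs ht' hr').2.1
  have h0 : mixedTable i j = 0 := by
    rcases mixedTable_eq_zero_or i j with h | h | h
    · exact h
    · exact absurd ⟨_, h⟩ h1
    · exact absurd ⟨_, (add_comm _ _).trans h⟩ h2
  rw [h0, Int.cast_zero]
  refine structConst_eq_zero fun t ht => ?_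
  rw [hr, hs] at ht
  obtain ⟨k, hk | hk⟩ := hroot t
  · refine h1 ⟨k, (posRoot_add_eq_iff hli).1 ?_⟩
    rw [← hk, ht]; abel
  · refine h2 ⟨k, (posRoot_add_eq_iff hli).1 ?_⟩
    rw [← neg_eq_iff_eq_neg.2 hk, ht]; abel

theorem structConst_neg_neg {r s : H.root} {i j : Fin 36} (hr : ρ r = -posRoot α i)
    (hs : ρ s = -posRoot α j) : structConst e r s = -positiveTable i j := by
  obtain ⟨r', hr'⟩ := exists_root_eq_posRoot_of_range hΦ i
  obtain ⟨s', hs'⟩ := exists_root_eq_posRoot_of_range hΦ j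
  by_cases h : ∃ k, code j + code i = code k
  · obtain ⟨k, hk⟩ := h
    obtain ⟨t, ht⟩ := exists_root_eq_posRoot_of_range hΦ k
    obtain ⟨t', ht'⟩ := exists_root_eq_neg_posRoot_of_range hΦ k
    exact (structConst_tables_of_add hli hΦ he hpos hk ht hs' hr' ht' hs hr).2.2
  · have h0 : positiveTable i j = 0 := (positiveTable_eq_zero_or i j).resolve_right
      fun h' => h ⟨_, (add_comm _ _).trans h'.symm⟩
    rw [h0, Int.cast_zero, neg_zero]
    refine structConst_eq_zero fun t ht => h ?_
    obtain ⟨t', ht'⟩ : ∃ t', ρ t' = posRoot α j + posRoot α i :=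
      ⟨(IsKilling.rootSystem H).reflectionPerm t t, by
        rw [RootPairing.root_reflectionPerm, RootPairing.reflection_apply_self, ht, hr, hs]; abel⟩
    obtain ⟨k, hk | hk⟩ := root_eq_posRoot_or_neg_of_range hΦ t'
    · exact ⟨k, (posRoot_add_eq_iff hli).1 (ht'.symm.trans hk)⟩
    · exfalso
      rw [hk] at ht'
      simp only [posRoot_eq_combination, ← combination_add, ← combination_neg] at ht'
      have := congrArg weight (combination_injective hli ht')
      simp only [weight_add, weight_neg, weight_posCoeff] at this
      have := code_pos i
      omega

end Tables

end E6

theorem theorem2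
    {L : Type*} [LieRing L] [LieAlgebra ℂ L] [FiniteDimensional ℂ L] [LieAlgebra.IsSimple ℂ L]
    (H : LieSubalgebra ℂ L) [H.IsCartanSubalgebra]
    -- the fundamental roots `a, b, c, d, e, f`, which have Cartan matrix of type `E₆`
    (B : (IsKilling.rootSystem H).Base) (ν : Fin 6 ≃ B.support)
    (hE₆ : ∀ i j, B.cartanMatrix (ν i) (ν j) = CartanMatrix.E₆ i j)
    (Φ : Set (Module.Dual ℂ H)) (hΦ : Φ = Set.range (IsKilling.rootSystem H).root)
    (α : Fin 6 → Module.Dual ℂ H) (hα : ∀ k, α k = (IsKilling.rootSystem H).root (ν k))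
    -- the root vectors, and the values on extraspecial pairs
    (e : H.root → L) (he : E6.IsRootVectorSystem e)
    (hN : ∀ r s : H.root,
      E6.IsExtraspecial Φ α
        ((IsKilling.rootSystem H).root r) ((IsKilling.rootSystem H).root s) →
      E6.structConst e r s = 1) :
    -- the roots are those listed and their negatives
    Φ = Set.range (E6.posRoot α) ∪ Set.range (fun i => -E6.posRoot α i) ∧
    -- the structure constants are those of the tables
    ∀ (r s : H.root) (i j : Fin 36),
      ((IsKilling.rootSystem H).root r = E6.posRoot α i →
        (IsKilling.rootSystem H).root s = E6.posRoot α j →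
          E6.structConst e r s = E6.positiveTable i j) ∧
      ((IsKilling.rootSystem H).root r = E6.posRoot α i →
        (IsKilling.rootSystem H).root s = -E6.posRoot α j →
          E6.structConst e r s = E6.mixedTable i j) ∧
      ((IsKilling.rootSystem H).root r = -E6.posRoot α i →
        (IsKilling.rootSystem H).root s = E6.posRoot α j →
          E6.structConst e r s = -E6.mixedTable j i) ∧
      ((IsKilling.rootSystem H).root r = -E6.posRoot α i →
        (IsKilling.rootSystem H).root s = -E6.posRoot α j →
          E6.structConst e r s = -E6.positiveTable i j) := by
  have hli := E6.linearIndependent_simple B ν hα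
  have hrange := E6.range_root B ν hE₆ hα
  subst hΦ
  have hpos := fun r s i j => E6.structConst_posRoot hli hrange he hN (r := r) (s := s) (i := i)
    (j := j)
  refine ⟨hrange, fun r s i j => ⟨hpos r s i j, fun hr hs => ?_, fun hr hs => ?_, fun hr hs => ?_⟩⟩
  · exact E6.structConst_posRoot_neg hli hrange he hpos hr hs
  · rw [E6.structConst_swap he, E6.structConst_posRoot_neg hli hrange he hpos hs hr]
  · exact E6.structConst_neg_neg hli hrange he hpos hr hs
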